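/- Fix a relational signature $\sigma$ consisting of countably infinitely many unary and countably infinitely many binary relation symbols; models are nonempty $\sigma$-structures. An abstract logic is a pair $\mathcal{L}=(\mathsf{Fml}_{\mathcal{L}},\models_{\mathcal{L}})$ of a set of sentences and a truth relation between models and sentences such that: - truth of $\mathcal{L}$-sentences is preserved under isomorphisms of models; - (Boolean connectives) for all $\varphi,\psi\in\mathcal{L}$ there are sentences of $\mathcal{L}$ expressing the negation of $\varphi$ and the conjunction of $\varphi$ and $\psi$; - (renamings) for every map $\rho$ sending relation symbols to relation symbols of the same arity and every $\varphi\in\mathcal{L}$ there is $\psi\in\mathcal{L}$ such that for all models $M$, $M\models\psi$ iff $\rho(M)\models\varphi$, where $\rho(M)$ has the domain of $M$ and interprets each symbol $R$ as $M$ interprets $\rho(R)$; - (relativisation) for every $\varphi\in\mathcal{L}$ and unary relation symbol $P$ there is $\psi\in\mathcal{L}$ such that for all models $M$ in which $P$ denotes a nonempty set, $M\models\psi$ iff $M^P\models\varphi$, where $M^P$ is the submodel of $M$ induced by the set denoted by $P$. $\mathcal{L}'$ is contained in $\mathcal{L}$ (equivalently, $\mathcal{L}$ extends $\mathcal{L}'$)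 if there is a map $f:\mathsf{Fml}_{\mathcal{L}'}\to\mathsf{Fml}_{\mathcal{L}}$ such that $M\models_{\mathcal{L}'}\varphi$ iff $M\models_{\mathcal{L}}f(\varphi)$ for all models $M$ and all $\varphi\in\mathcal{L}'$. $\mathcal{L}$ has Compactness if every set of $\mathcal{L}$-sentences all of whose finite subsets are satisfiable is satisfiable, and it has the Löwenheim–Skolem property if every satisfiable set of $\mathcal{L}$-sentences has a countable (possibly finite) model. $FO$ denotes first-order logic with equality over $\sigma$, and $FO^3$ its fragment consisting of the sentences that use only three variables (which may be requantified). **Theorem.** An abstract logic extending $FO^3$ is contained in $FO$ if and only if it has both Compactness and the Löwenheim–Skolem property. -/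

import Mathlib

open FirstOrder

universe u v w

namespace AbstractModelTheory

/-- The relation symbols: countably infinitely many unary ones and countably infinitely many
binary ones. -/
inductive RelSymb : ℕ → Type
  | unary (i : ℕ) : RelSymb 1
  | binary (i : ℕ) : RelSymb 2

/-- The fixed relational signature. -/
def vocab : FirstOrder.Language.{0, 0} where
  Functions := fun _ => Empty
  Relations := RelSymb

instance : vocab.IsRelational := fun _ => inferInstanceAs (IsEmpty Empty)

/-- Models: nonempty structures for the fixed signature. -/
structure Model where
  /-- the domain -/
  Carrier : Type u
  /-- the interpretation of the relation symbols -/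
  [str : vocab.Structure Carrier]
  /-- domains are nonempty -/
  [nonempty : Nonempty Carrier]

namespace Model

instance : CoeSort Model.{u} (Type u) := ⟨Model.Carrier⟩

instance (M : Model.{u}) : vocab.Structure M := M.str

instance (M : Model.{u}) : Nonempty M := M.nonempty

/-- The subset of the domain defined by a unary relation symbol. -/
def ext (M : Model.{u}) (P : vocab.Relations 1) : Set M :=
  {a | FirstOrder.Language.Structure.RelMap P ![a]}

/-- `M.rename ρ` is `ρ(M)`: the model with the same domain as `M` in which each relation symbol
`R` denotes what `ρ(R)` denotes in `M`. Since `vocab` has no function symbols, a language map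
`vocab →ᴸ vocab` is just an arity-preserving map of relation symbols. -/
def rename (ρ : vocab →ᴸ vocab) (M : Model.{u}) : Model.{u} :=
  letI : vocab.Structure M.Carrier := ρ.reduct M.Carrier
  { Carrier := M.Carrier }

/-- The submodel of `M` induced by a nonempty subset `S` of its domain. -/
def restrict (M : Model.{u}) (S : Set M) (hS : S.Nonempty) : Model.{u} :=
  letI : vocab.Structure S :=
    { funMap := fun f _ => isEmptyElim f
      RelMap := fun R xs => FirstOrder.Language.Structure.RelMap R (fun i => (xs i : M)) }
  haveI : Nonempty S := hS.to_subtype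
  { Carrier := S }

end Model

/-- A pair `(Fml, ⊨)` of a collection of sentences and a truth relation between models and
sentences. -/
structure Logic where
  /-- the sentences -/
  Fml : Type v
  /-- the truth relation -/
  Sat : Model.{u} → Fml → Prop

namespace Logic

/-- The requirements for such a pair to be an abstract logic. -/
structure IsAbstract (L : Logic.{u, v}) : Prop where
  /-- sentences are preserved under isomorphisms -/
  iso_invariant : ∀ (M N : Model.{u}), Nonempty (M ≃[vocab] N) → ∀ φ : L.Fml, L.Sat M φ → L.Sat N φ
  /-- closure under negation -/
  closed_neg : ∀ φ : L.Fml, ∃ ψ : L.Fml, ∀ M : Model.{u}, L.Sat M ψ ↔ ¬ L.Sat M φ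
  /-- closure under conjunction -/
  closed_and : ∀ φ ψ : L.Fml, ∃ χ : L.Fml, ∀ M : Model.{u}, L.Sat M χ ↔ L.Sat M φ ∧ L.Sat M ψ
  /-- closure under renamings -/
  closed_rename : ∀ (ρ : vocab →ᴸ vocab) (φ : L.Fml), ∃ ψ : L.Fml,
    ∀ M : Model.{u}, L.Sat M ψ ↔ L.Sat (M.rename ρ) φ
  /-- closure under relativisation by unary predicates; the submodel exists when the
  predicate is nonempty -/
  closed_restrict : ∀ (φ : L.Fml) (P : vocab.Relations 1), ∃ ψ : L.Fml,
    ∀ (M : Model.{u}) (hP : (M.ext P).Nonempty),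
      L.Sat M ψ ↔ L.Sat (M.restrict (M.ext P) hP) φ

/-- `L` is contained in `L'` (equivalently, `L'` extends `L`): there is a truth-preserving map
from the sentences of `L` to the sentences of `L'`. -/
def ContainedIn (L : Logic.{u, v}) (L' : Logic.{u, w}) : Prop :=
  ∃ f : L.Fml → L'.Fml, ∀ (M : Model.{u}) (φ : L.Fml), L.Sat M φ ↔ L'.Sat M (f φ)

/-- `M` is a model of every sentence in `T`. -/
def SatSet (L : Logic.{u, v}) (M : Model.{u}) (T : Set L.Fml) : Prop :=
  ∀ φ ∈ T, L.Sat M φ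

/-- A set of sentences is satisfiable if it has a model. -/
def Satisfiable (L : Logic.{u, v}) (T : Set L.Fml) : Prop :=
  ∃ M : Model.{u}, L.SatSet M T

/-- Compactness, for arbitrary sets of sentences. -/
def HasCompactness (L : Logic.{u, v}) : Prop :=
  ∀ T : Set L.Fml, (∀ T₀ : Set L.Fml, T₀ ⊆ T → T₀.Finite → L.Satisfiable T₀) → L.Satisfiable T

/-- The Löwenheim–Skolem property: every satisfiable set of sentences has a countable (finite or
countably infinite) model. -/
def HasLowenheimSkolem (L : Logic.{u, v}) : Prop :=
  ∀ T : Set L.Fml, L.Satisfiable T → ∃ M : Model.{u}, Countable M ∧ L.SatSet M T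

end Logic

/-- First-order logic (with equality) over the fixed signature. -/
def FO : Logic.{u, 0} where
  Fml := vocab.Sentence
  Sat M φ := M ⊨ φ

/-- First-order formulas (with equality) written with named variables from `V`; variables may be
requantified. -/
inductive VarFormula (V : Type) : Type
  | eq (x y : V) : VarFormula V
  | rel {n : ℕ} (R : vocab.Relations n) (xs : Fin n → V) : VarFormula V
  | not (φ : VarFormula V) : VarFormula V
  | and (φ ψ : VarFormula V) : VarFormula V
  | ex (x : V) (φ : VarFormula V) : VarFormula V

namespace VarFormula

variable {V : Type}

/-- The free variables of a formula. -/
def freeVars : VarFormula V → Set V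
  | eq x y => {x, y}
  | rel _ xs => Set.range xs
  | not φ => φ.freeVars
  | and φ ψ => φ.freeVars ∪ ψ.freeVars
  | ex x φ => φ.freeVars \ {x}

/-- Truth of a formula in a model under an assignment. -/
def Realize [DecidableEq V] (M : Model.{u}) : VarFormula V → (V → M) → Prop
  | eq x y, s => s x = s y
  | rel R xs, s => FirstOrder.Language.Structure.RelMap R (fun i => s (xs i))
  | not φ, s => ¬ φ.Realize M s
  | and φ ψ, s => φ.Realize M s ∧ ψ.Realize M s
  | ex x φ, s => ∃ a : M, φ.Realize M (Function.update s x a)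

end VarFormula

/-- The `k`-variable fragment `FO^k`: its sentences are the first-order formulas without free
variables that are written with (free or bound) variables among `k` fixed variables. The truth of
such a sentence does not depend on the assignment. -/
def FOVar (k : ℕ) : Logic.{u, 0} where
  Fml := {φ : VarFormula (Fin k) // φ.freeVars = ∅}
  Sat M φ := ∀ s : Fin k → M, φ.1.Realize M s

end AbstractModelTheory

/-! First-order logic has both properties, and both pull back along a containment. For the converse,
suppose that `φ` has no first-order equivalent. Agreement on finitely many first-order formulas
guarantees that Duplicator survives a given number of rounds over finitely many symbols
(`exists_formulas_survives`). Hence, by `exists_sentence_of_survives`, for every `m` some two models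
disagree on `φ` although Duplicator survives `m + 1` rounds over the first `m` symbols of each
arity.

Both models and the positions of the game are coded in a single model. Since positions are elements,
linked to their entries by binary relations, three variables suffice for every clause of the coding
(`Logic.defines_codesGame`); renaming and relativisation let the logic evaluate `φ` in each coded
model (`Logic.defines_part`). Compactness and Löwenheim–Skolem yield a countable model coding an
endless game between models that disagree on `φ` (`Logic.exists_countable_model`). Back-and-forth
along one infinite play makes these two isomorphic (`Model.nonempty_part_equiv`), a contradiction.
-/

namespace AbstractModelTheory

open FirstOrder.Language

/-! ### Isomorphisms of models with unary and binary relations -/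

namespace Model

/-- The unary relation denoted by the `i`-th unary symbol. -/
def un (K : Model.{u}) (i : ℕ) (a : K) : Prop :=
  Structure.RelMap (L := vocab) (n := 1) (RelSymb.unary i) ![a]

/-- The binary relation denoted by the `i`-th binary symbol. -/
def bin (K : Model.{u}) (i : ℕ) (a b : K) : Prop :=
  Structure.RelMap (L := vocab) (n := 2) (RelSymb.binary i) ![a, b]

/-- The model with given interpretations of the unary and binary symbols. -/
def ofRel (C : Type u) [Nonempty C] (un : ℕ → C → Prop) (bin : ℕ → C → C → Prop) : Model.{u} :=
  letI : vocab.Structure C :=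
    { funMap := fun f _ => isEmptyElim f
      RelMap := fun {_} R => match R with
        | RelSymb.unary i => fun xs => un i (xs 0)
        | RelSymb.binary i => fun xs => bin i (xs 0) (xs 1) }
  { Carrier := C }

/-- A bijection preserving unary and binary relations is an isomorphism. -/
theorem nonempty_equiv_of_bijective {M N : Model.{u}} (f : M → N) (hf : f.Bijective)
    (hun : ∀ i a, N.un i (f a) ↔ M.un i a) (hbin : ∀ i a b, N.bin i (f a) (f b) ↔ M.bin i a b) :
    Nonempty (M ≃[vocab] N) := by
  refine ⟨{ Equiv.ofBijective f hf with
    map_fun' := fun g _ => isEmptyElim g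
    map_rel' := fun {n} R x => ?_ }⟩
  change Structure.RelMap R (f ∘ x) ↔ Structure.RelMap R x
  cases R with
  | unary i =>
    have h1 : x = ![x 0] := by ext j; fin_cases j; rfl
    have h2 : f ∘ x = ![f (x 0)] := by ext j; fin_cases j; rfl
    rw [h2, h1]
    exact hun i (x 0)
  | binary i =>
    have h1 : x = ![x 0, x 1] := by ext j; fin_cases j <;> rfl
    have h2 : f ∘ x = ![f (x 0), f (x 1)] := by ext j; fin_cases j <;> rfl
    rw [h2, h1]
    exact hbin i (x 0) (x 1)

/-- Two models enumerated by sequences with the same atomic type are isomorphic. -/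
theorem nonempty_equiv_of_enum {M N : Model.{u}} (a : ℕ → M) (b : ℕ → N)
    (ha : a.Surjective) (hb : b.Surjective) (heq : ∀ i j, a i = a j ↔ b i = b j)
    (hun : ∀ k i, M.un k (a i) ↔ N.un k (b i))
    (hbin : ∀ k i j, M.bin k (a i) (a j) ↔ N.bin k (b i) (b j)) :
    Nonempty (M ≃[vocab] N) := by
  have hr := Function.rightInverse_surjInv ha
  refine nonempty_equiv_of_bijective (fun x => b (Function.surjInv ha x)) ⟨?_, ?_⟩ ?_ ?_
  · intro x y hxy
    rw [← hr x, ← hr y]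
    exact (heq _ _).2 hxy
  · intro y
    obtain ⟨i, rfl⟩ := hb y
    exact ⟨a i, (heq _ _).1 (hr _)⟩
  · intro k x
    rw [← hun, hr]
  · intro k x y
    rw [← hbin, hr, hr]

end Model

/-! ### First-order logic has Compactness and the Löwenheim–Skolem property -/

theorem card_vocab_le : vocab.card ≤ Cardinal.aleph0 := by
  have : Countable vocab.Symbols := by
    have h1 : Countable (Σ l, vocab.Functions l) :=
      (inferInstance : Countable (Σ l : ℕ, (fun _ => Empty) l))
    have h2 : Countable (Σ l, vocab.Relations l) := by
      let f : ℕ ⊕ ℕ → Σ l, vocab.Relations l :=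
        Sum.elim (fun i => ⟨1, RelSymb.unary i⟩) (fun i => ⟨2, RelSymb.binary i⟩)
      refine Function.Surjective.countable (f := f) ?_
      rintro ⟨l, R⟩
      cases R with
      | unary i => exact ⟨Sum.inl i, rfl⟩
      | binary i => exact ⟨Sum.inr i, rfl⟩
    exact inferInstanceAs (Countable ((Σ l, vocab.Functions l) ⊕ (Σ l, vocab.Relations l)))
  exact Cardinal.mk_le_aleph0

theorem FO.satisfiable_iff (T : Set vocab.Sentence) :
    FO.{u}.Satisfiable T ↔ Theory.IsSatisfiable (L := vocab) T := by
  constructor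
  · rintro ⟨M, hM⟩
    have : (M : Type u) ⊨ (T : vocab.Theory) := ⟨fun {φ} h => hM φ h⟩
    exact Theory.Model.isSatisfiable (M : Type u)
  · rintro ⟨M⟩
    refine ⟨⟨(Theory.ModelType.ulift.{0, 0, 0, u} M : Type u)⟩, fun φ hφ => ?_⟩
    exact Theory.realize_sentence_of_mem (M := Theory.ModelType.ulift.{0, 0, 0, u} M) T hφ

theorem FO.hasCompactness : FO.{u}.HasCompactness := by
  intro T hT
  refine (FO.satisfiable_iff T).2 ?_
  refine Theory.isSatisfiable_iff_isFinitelySatisfiable.2 fun T₀ hT₀ => ?_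
  exact (FO.satisfiable_iff _).1 (hT _ hT₀ T₀.finite_toSet)

theorem FO.hasLowenheimSkolem : FO.{u}.HasLowenheimSkolem := by
  rintro T ⟨M, hM⟩
  rcases le_total (Cardinal.mk M) Cardinal.aleph0 with h | h
  · exact ⟨M, Cardinal.mk_le_aleph0_iff.1 h, hM⟩
  -- An elementary substructure of size exactly `ℵ₀` needs an infinite model, so countable models
  -- were kept as they are.
  · obtain ⟨S, -, hS⟩ := exists_elementarySubstructure_card_eq vocab (∅ : Set M)
      Cardinal.aleph0.{u} le_rfl (by simp) (by simpa using card_vocab_le) (by simpa using h)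
    refine ⟨⟨S⟩, Cardinal.mk_le_aleph0_iff.1 (by simpa using hS.le), fun φ hφ => ?_⟩
    exact (S.realize_sentence φ).2 (hM φ hφ)

/-! ### Both properties pass to contained logics -/

namespace Logic

variable {L : Logic.{u, v}} {L' : Logic.{u, w}}

theorem ContainedIn.satSet_iff {f : L.Fml → L'.Fml}
    (hf : ∀ (M : Model.{u}) φ, L.Sat M φ ↔ L'.Sat M (f φ)) (M : Model.{u}) (T : Set L.Fml) :
    L.SatSet M T ↔ L'.SatSet M (f '' T) := by
  simp [SatSet, hf]

theorem ContainedIn.hasCompactness (h : L.ContainedIn L') (hc : L'.HasCompactness) :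
    L.HasCompactness := by
  obtain ⟨f, hf⟩ := h
  intro T hT
  have key := ContainedIn.satSet_iff hf
  obtain ⟨M, hM⟩ := hc (f '' T) fun T₀ h₀ hfin => by
    obtain ⟨T₁, h₁, hfin₁, rfl⟩ := Set.exists_subset_image_finite_and.1 ⟨T₀, h₀, hfin, rfl⟩
    obtain ⟨M, hM⟩ := hT T₁ h₁ hfin₁
    exact ⟨M, (key M T₁).1 hM⟩
  exact ⟨M, (key M T).2 hM⟩

theorem ContainedIn.hasLowenheimSkolem (h : L.ContainedIn L') (hc : L'.HasLowenheimSkolem) :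
    L.HasLowenheimSkolem := by
  obtain ⟨f, hf⟩ := h
  have key := ContainedIn.satSet_iff hf
  rintro T ⟨M, hM⟩
  obtain ⟨N, hN, hNT⟩ := hc (f '' T) ⟨M, (key M T).1 hM⟩
  exact ⟨N, hN, (key N T).2 hNT⟩

end Logic

/-! ### Ehrenfeucht–Fraïssé games -/

variable {D : Bool → Model.{u}}

/-- The first `n` entries of the two sequences satisfy the same atomic formulas over the first
`m` unary and the first `m` binary symbols. -/
structure SameAtoms (m n : ℕ) (s : ∀ b, ℕ → D b) : Prop where
  eq : ∀ b b', ∀ i < n, ∀ j < n, s b i = s b j → s b' i = s b' j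
  un : ∀ b b', ∀ k < m, ∀ i < n, (D b).un k (s b i) → (D b').un k (s b' i)
  bin : ∀ b b', ∀ k < m, ∀ i < n, ∀ j < n, (D b).bin k (s b i) (s b j) →
    (D b').bin k (s b' i) (s b' j)

/-- Duplicator survives `r` more rounds of the game in which the first `n` entries of the two
sequences have been played. -/
def Survives (m : ℕ) : ℕ → ℕ → (∀ b, ℕ → D b) → Prop
  | 0, n, s => SameAtoms m n s
  | r + 1, n, s => SameAtoms m n s ∧ ∀ b, ∀ x : D b, ∃ s' : ∀ b, ℕ → D b,
      (∀ c, ∀ i < n, s' c i = s c i) ∧ s' b n = x ∧ Survives m r (n + 1) s'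

theorem Survives.sameAtoms {m r n : ℕ} {s : ∀ b, ℕ → D b} (h : Survives m r n s) :
    SameAtoms m n s := by
  cases r with
  | zero => exact h
  | succ r => exact h.1

theorem realize_ite_not {M : Model.{u}} {n : ℕ} (χ : vocab.BoundedFormula Empty n)
    (S : Prop) [Decidable S] (v : Fin n → M) :
    (if S then χ else ∼χ).Realize default v ↔ (χ.Realize default v ↔ S) := by
  split_ifs with h <;> simp [h]

/-- The formula stating which members of a finite family of formulas hold. -/
theorem exists_pattern {ι : Type} [Finite ι] {n : ℕ} (χ : ι → vocab.BoundedFormula Empty n)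
    (S : Set ι) : ∃ ψ : vocab.BoundedFormula Empty n, ∀ (M : Model.{u}) (v : Fin n → M),
      ψ.Realize default v ↔ ∀ i, ((χ i).Realize default v ↔ i ∈ S) := by
  classical
  refine ⟨BoundedFormula.iInf fun i => if i ∈ S then χ i else ∼(χ i), fun M v => ?_⟩
  rw [BoundedFormula.realize_iInf]
  exact forall_congr' fun i => realize_ite_not _ _ _

/-- A finite family of formulas decides whether Duplicator survives. -/
theorem exists_formulas_survives (m r n : ℕ) :
    ∃ (ι : Type) (_ : Finite ι) (χ : ι → vocab.BoundedFormula Empty n),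
      ∀ (D : Bool → Model.{u}) (s : ∀ b, ℕ → D b),
        (∀ i b b', (χ i).Realize default (fun j : Fin n => s b j) →
          (χ i).Realize default (fun j : Fin n => s b' j)) → Survives m r n s := by
  have atoms (n : ℕ) : ∃ (ι : Type) (_ : Finite ι) (χ : ι → vocab.BoundedFormula Empty n),
      ∀ (D : Bool → Model.{u}) (s : ∀ b, ℕ → D b),
        (∀ i b b', (χ i).Realize default (fun j : Fin n => s b j) →
          (χ i).Realize default (fun j : Fin n => s b' j)) → SameAtoms m n s := by
    refine ⟨(Fin n × Fin n) ⊕ (Fin m × Fin n) ⊕ (Fin m × Fin n × Fin n), inferInstance,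
      Sum.elim (fun p => Term.bdEqual (.var (.inr p.1)) (.var (.inr p.2)))
        (Sum.elim (fun p => Relations.boundedFormula₁ (L := vocab) (RelSymb.unary p.1)
            (.var (.inr p.2)))
          (fun p => Relations.boundedFormula₂ (L := vocab) (RelSymb.binary p.1)
            (.var (.inr p.2.1)) (.var (.inr p.2.2)))), fun D s h => ⟨?_, ?_, ?_⟩⟩
    · intro b b' i hi j hj
      exact h (.inl (⟨i, hi⟩, ⟨j, hj⟩)) b b'
    · intro b b' k hk i hi
      exact fun H => BoundedFormula.realize_rel₁.1
        (h (.inr (.inl (⟨k, hk⟩, ⟨i, hi⟩))) b b' (BoundedFormula.realize_rel₁.2 H))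
    · intro b b' k hk i hi j hj
      exact fun H => BoundedFormula.realize_rel₂.1
        (h (.inr (.inr (⟨k, hk⟩, ⟨i, hi⟩, ⟨j, hj⟩))) b b' (BoundedFormula.realize_rel₂.2 H))
  induction r generalizing n with
  | zero => exact atoms n
  | succ r ih =>
    obtain ⟨ι₀, _, χ₀, h₀⟩ := atoms n
    obtain ⟨ι, _, χ, h⟩ := ih (n + 1)
    choose ψ hψ using exists_pattern.{u} χ
    -- For each set `S` of formulas of the next stage, one formula says that some further entry
    -- realizes exactly those in `S`.
    refine ⟨ι₀ ⊕ Set ι, inferInstance, Sum.elim χ₀ fun S => ∃' ψ S, fun D s hs => ?_⟩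
    refine ⟨h₀ D s fun i => hs (.inl i), fun b x => ?_⟩
    have hsnoc (c : Bool) (y : D c) : (Fin.snoc (fun j : Fin n => s c j) y : Fin (n + 1) → D c) =
        fun j : Fin (n + 1) => Function.update (s c) n y j := by
      ext j
      refine Fin.lastCases ?_ (fun j => ?_) j
      · simp
      · simp [j.2.ne]
    let S : Set ι := {i | (χ i).Realize default fun j : Fin (n + 1) => Function.update (s b) n x j}
    have hb : (∃' ψ S).Realize default fun j : Fin n => s b j := by
      rw [BoundedFormula.realize_ex]
      refine ⟨x, ?_⟩
      rw [hsnoc, hψ]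
      exact fun i => Iff.rfl
    have hc (c : Bool) : ∃ y : D c, ∀ i, ((χ i).Realize default
        fun j : Fin (n + 1) => Function.update (s c) n y j) ↔ i ∈ S := by
      have := hs (.inr S) b c hb
      obtain ⟨y, hy⟩ := BoundedFormula.realize_ex.1 this
      rw [hsnoc, hψ] at hy
      exact ⟨y, hy⟩
    choose y hy using hc
    -- The witness chosen on side `b` need not be Spoiler's move `x`; replacing it by `x` keeps the
    -- pattern `S`.
    have hy' (c : Bool) (i : ι) : ((χ i).Realize default
        fun j : Fin (n + 1) => Function.update (s c) n (Function.update y b x c) j) ↔ i ∈ S := by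
      by_cases hcb : c = b
      · subst hcb
        rw [Function.update_self]
        exact Iff.rfl
      · rw [Function.update_of_ne hcb]
        exact hy c i
    refine ⟨fun c => Function.update (s c) n (Function.update y b x c), fun c i hi => ?_, ?_, ?_⟩
    · exact Function.update_of_ne hi.ne _ _
    · simp
    · exact h D _ fun i c c' hi => (hy' c' i).2 ((hy' c i).1 hi)

/-- A property of models which does not distinguish models that are equivalent for the game is
first-order. -/
theorem exists_sentence_of_survives (Q : Model.{u} → Prop) (m r : ℕ)
    (hQ : ∀ (D : Bool → Model.{u}) (s : ∀ b, ℕ → D b), Survives m r 0 s → Q (D true) →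
      Q (D false)) :
    ∃ ψ : vocab.Sentence, ∀ M : Model.{u}, Q M ↔ FO.{u}.Sat M ψ := by
  obtain ⟨ι, _, χ, h⟩ := exists_formulas_survives.{u} m r 0
  choose ψ hψ using exists_pattern.{u} χ
  let tp (M : Model.{u}) : Set ι := {i | (χ i).Realize (M := M) default default}
  -- There are finitely many types, so the disjunction over those realized in models of `Q` is a
  -- sentence.
  let X : Set (Set ι) := {S | ∃ M, Q M ∧ tp M = S}
  have hpat (M : Model.{u}) (S : Set ι) : (ψ S).Realize (M := M) default default ↔ tp M = S := by
    rw [hψ, Set.ext_iff]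
    rfl
  refine ⟨BoundedFormula.iSup fun S : X => ψ S, fun M => ?_⟩
  change _ ↔ BoundedFormula.Realize _ _ _
  rw [BoundedFormula.realize_iSup]
  constructor
  · exact fun hM => ⟨⟨tp M, M, hM, rfl⟩, (hpat M _).2 rfl⟩
  · rintro ⟨⟨S, N, hN, hS⟩, hM⟩
    have hM := hS.trans ((hpat M S).1 hM).symm
    let D : Bool → Model.{u} := fun b => bif b then N else M
    have htp : ∀ b b', tp (D b) = tp (D b') := by
      rintro (_ | _) (_ | _) <;> first | rfl | exact hM | exact hM.symm
    refine hQ D (fun b _ => Classical.arbitrary _) (h _ _ fun i b b' hi => ?_) hN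
    have e (c : Bool) (g : Fin 0 → D c) : g = default := Subsingleton.elim _ _
    rw [e b fun _ => _] at hi
    rw [e b' fun _ => _]
    exact (htp b b').subset hi

/-! ### Properties of models that are definable in an abstract logic -/

namespace VarFormula

variable {V : Type}

/-- Implication. -/
def imp (φ ψ : VarFormula V) : VarFormula V := not (and φ (not ψ))

/-- Universal quantification. -/
def all (x : V) (φ : VarFormula V) : VarFormula V := not (ex x (not φ))

/-- The atomic formula applying the `i`-th unary symbol. -/
def un (i : ℕ) (x : V) : VarFormula V := rel (n := 1) (RelSymb.unary i) ![x]

/-- The atomic formula applying the `i`-th binary symbol. -/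
def bin (i : ℕ) (x y : V) : VarFormula V := rel (n := 2) (RelSymb.binary i) ![x, y]

@[simp] theorem freeVars_imp (φ ψ : VarFormula V) :
    (imp φ ψ).freeVars = φ.freeVars ∪ ψ.freeVars := rfl

@[simp] theorem freeVars_all (x : V) (φ : VarFormula V) :
    (all x φ).freeVars = φ.freeVars \ {x} := rfl

@[simp] theorem freeVars_un (i : ℕ) (x : V) : (un i x).freeVars = {x} := by
  simp [un, freeVars]

@[simp] theorem freeVars_bin (i : ℕ) (x y : V) : (bin i x y).freeVars = {x, y} := by
  simp [bin, freeVars, Set.pair_comm]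

variable [DecidableEq V] (K : Model.{u}) (s : V → K)

@[simp] theorem realize_imp (φ ψ : VarFormula V) :
    (imp φ ψ).Realize K s ↔ (φ.Realize K s → ψ.Realize K s) := by
  simp [imp, Realize]

@[simp] theorem realize_all (x : V) (φ : VarFormula V) :
    (all x φ).Realize K s ↔ ∀ a, φ.Realize K (Function.update s x a) := by
  simp [all, Realize]

@[simp] theorem realize_un (i : ℕ) (x : V) : (un i x).Realize K s ↔ K.un i (s x) := by
  have : (fun j : Fin 1 => s (![x] j)) = ![s x] := by ext j; fin_cases j; rfl
  simp only [un, Realize, Model.un, this]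

@[simp] theorem realize_bin (i : ℕ) (x y : V) : (bin i x y).Realize K s ↔ K.bin i (s x) (s y) := by
  have : (fun j : Fin 2 => s (![x, y] j)) = ![s x, s y] := by ext j; fin_cases j <;> rfl
  simp only [bin, Realize, Model.bin, this]

end VarFormula

namespace Logic

/-- A property of models is definable in a logic if some sentence expresses it. -/
def Defines (L : Logic.{u, v}) (Q : Model.{u} → Prop) : Prop :=
  ∃ ψ : L.Fml, ∀ K, L.Sat K ψ ↔ Q K

variable {L : Logic.{u, v}} {Q Q' : Model.{u} → Prop}

theorem Defines.congr (h : L.Defines Q) (hQ : ∀ K, Q K ↔ Q' K) : L.Defines Q' := by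
  obtain ⟨ψ, hψ⟩ := h
  exact ⟨ψ, fun K => (hψ K).trans (hQ K)⟩

theorem Defines.and (hL : L.IsAbstract) (h : L.Defines Q) (h' : L.Defines Q') :
    L.Defines fun K => Q K ∧ Q' K := by
  obtain ⟨ψ, hψ⟩ := h
  obtain ⟨ψ', hψ'⟩ := h'
  obtain ⟨χ, hχ⟩ := hL.closed_and ψ ψ'
  exact ⟨χ, fun K => by rw [hχ, hψ, hψ']⟩

theorem Defines.forall_bool (hL : L.IsAbstract) {Q : Bool → Model.{u} → Prop}
    (h : ∀ b, L.Defines (Q b)) : L.Defines fun K => ∀ b, Q b K :=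
  ((h false).and hL (h true)).congr fun K =>
    (Bool.forall_bool (p := fun b => Q b K)).symm

/-- As `Q` ignores the assignment, truth under all assignments reduces to truth under one, which
exists because models are nonempty. -/
theorem defines_of_realize (hExt : (FOVar.{u} 3).ContainedIn L) (φ : VarFormula (Fin 3))
    (hφ : φ.freeVars = ∅) (hQ : ∀ (K : Model.{u}) (s : Fin 3 → K), φ.Realize K s ↔ Q K) :
    L.Defines Q := by
  obtain ⟨f, hf⟩ := hExt
  refine ⟨f ⟨φ, hφ⟩, fun K => ?_⟩
  refine (hf K ⟨φ, hφ⟩).symm.trans ?_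
  exact ⟨fun h => (hQ K fun _ => Classical.arbitrary _).1 (h _), fun h s => (hQ K s).2 h⟩

/-! ### Three-variable sentences for the clauses of the coding -/

section FO3

open VarFormula

variable (hExt : (FOVar.{u} 3).ContainedIn L)
include hExt

theorem defines_true : L.Defines fun _ => True :=
  defines_of_realize hExt (all 0 (eq 0 0)) (by simp [freeVars]) (by simp [Realize])

theorem defines_exists_un (a : ℕ) : L.Defines fun K => ∃ x, K.un a x :=
  defines_of_realize hExt (ex 0 (un a 0)) (by simp [freeVars]) (by simp [Realize])

theorem defines_forth (a b c d e : ℕ) : L.Defines fun K => ∀ p x, K.un a p → K.un b x →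
    ∃ p', K.bin c p p' ∧ K.un d p' ∧ K.bin e p' x :=
  defines_of_realize hExt
    (all 0 (all 1 (imp (un a 0) (imp (un b 1)
      (ex 2 (and (bin c 0 2) (and (un d 2) (bin e 2 1))))))))
    (by ext x; fin_cases x <;> simp [freeVars]) (by simp [Realize])

theorem defines_transfer (a b : ℕ) : L.Defines fun K => ∀ p p' x, K.bin a p p' → K.bin b p x →
    K.bin b p' x :=
  defines_of_realize hExt
    (all 0 (all 1 (all 2 (imp (bin a 0 1) (imp (bin b 0 2) (bin b 1 2))))))
    (by ext x; fin_cases x <;> simp) (by simp)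

theorem defines_total (a b c : ℕ) : L.Defines fun K => ∀ p, K.un a p →
    ∃ x, K.un b x ∧ K.bin c p x :=
  defines_of_realize hExt (all 0 (imp (un a 0) (ex 1 (and (un b 1) (bin c 0 1)))))
    (by ext x; fin_cases x <;> simp [freeVars]) (by simp [Realize])

theorem defines_functional (a : ℕ) : L.Defines fun K => ∀ p x y, K.bin a p x → K.bin a p y →
    x = y :=
  defines_of_realize hExt
    (all 0 (all 1 (all 2 (imp (bin a 0 1) (imp (bin a 0 2) (eq 1 2))))))
    (by ext x; fin_cases x <;> simp [freeVars]) (by simp [Realize])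

theorem defines_eq (a b c d e : ℕ) : L.Defines fun K => ∀ p, K.un a p →
    (∃ x, K.bin b p x ∧ K.bin c p x) → ∃ x, K.bin d p x ∧ K.bin e p x :=
  defines_of_realize hExt (all 0 (imp (un a 0) (imp (ex 1 (and (bin b 0 1) (bin c 0 1)))
      (ex 1 (and (bin d 0 1) (bin e 0 1))))))
    (by ext x; fin_cases x <;> simp [freeVars]) (by simp [Realize])

theorem defines_un (a b c k : ℕ) : L.Defines fun K => ∀ p, K.un a p →
    (∃ x, K.bin b p x ∧ K.un k x) → ∃ x, K.bin c p x ∧ K.un k x :=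
  defines_of_realize hExt (all 0 (imp (un a 0) (imp (ex 1 (and (bin b 0 1) (un k 1)))
      (ex 1 (and (bin c 0 1) (un k 1))))))
    (by ext x; fin_cases x <;> simp [freeVars]) (by simp [Realize])

theorem defines_bin (a b c d e k : ℕ) : L.Defines fun K => ∀ p, K.un a p →
    (∃ x, K.bin b p x ∧ ∃ y, K.bin c p y ∧ K.bin k x y) →
    ∃ x, K.bin d p x ∧ ∃ y, K.bin e p y ∧ K.bin k x y :=
  defines_of_realize hExt (all 0 (imp (un a 0)
      (imp (ex 1 (and (bin b 0 1) (ex 2 (and (bin c 0 2) (bin k 1 2)))))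
        (ex 1 (and (bin d 0 1) (ex 2 (and (bin e 0 2) (bin k 1 2))))))))
    (by ext x; fin_cases x <;> simp [freeVars]) (by simp [Realize])

theorem Defines.forall_lt (hL : L.IsAbstract) {Q : ℕ → Model.{u} → Prop}
    (h : ∀ i, L.Defines (Q i)) (n : ℕ) : L.Defines fun K => ∀ i < n, Q i K := by
  induction n with
  | zero => exact (defines_true hExt).congr fun K => by simp
  | succ n ih => exact (ih.and hL (h n)).congr fun K => Nat.forall_lt_succ_right.symm

end FO3

/-- Compactness and the Löwenheim–Skolem property in terms of definable properties. -/
theorem exists_countable_model (hc : L.HasCompactness) (hls : L.HasLowenheimSkolem)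
    {Q : ℕ → Model.{u} → Prop} (hQ : ∀ n, L.Defines (Q n)) (h : ∀ m, ∃ K, ∀ n ≤ m, Q n K) :
    ∃ K : Model.{u}, Countable K ∧ ∀ n, Q n K := by
  choose ψ hψ using hQ
  obtain ⟨K, hK, hT⟩ := hls (Set.range ψ) <| hc _ fun T₀ h₀ hfin => by
    obtain ⟨J, -, hJ, rfl⟩ := Set.exists_subset_image_finite_and.1
      ⟨T₀, Set.image_univ (f := ψ) ▸ h₀, hfin, rfl⟩
    -- A finite set of these sentences mentions only indices up to some `m`.
    obtain ⟨m, hm⟩ := hJ.bddAbove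
    obtain ⟨K, hK⟩ := h m
    refine ⟨K, ?_⟩
    rintro _ ⟨n, hn, rfl⟩
    exact (hψ n K).2 (hK n (hm hn))
  exact ⟨K, hK, fun n => (hψ n K).1 (hT _ ⟨n, rfl⟩)⟩

end Logic

/-! ### Coding two models and positions of the game on them in a single model -/

/-- The index of the unary symbol coding the `k`-th unary relation of the two models. -/
abbrev cP (k : ℕ) : ℕ := Nat.pair 0 k

/-- The index of the unary symbol for the admissible positions of length `n`. -/
abbrev cU (n : ℕ) : ℕ := Nat.pair 1 n

/-- The index of the unary symbol for the domain of one of the two models. -/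
abbrev cD (b : Bool) : ℕ := Nat.pair 2 b.toNat

/-- The index of the binary symbol coding the `k`-th binary relation of the two models. -/
abbrev cR (k : ℕ) : ℕ := Nat.pair 0 k

/-- The index of the binary symbol relating positions with the same first `n` entries. -/
abbrev cE (n : ℕ) : ℕ := Nat.pair 1 n

/-- The index of the binary symbol relating a position to its `i`-th entry. -/
abbrev cV (b : Bool) (i : ℕ) : ℕ := Nat.pair (2 + b.toNat) i

/-- The renaming that reads off the original relations from the coding ones. -/
def decode : vocab →ᴸ vocab where
  onFunction := fun {_} f => isEmptyElim f
  onRelation := fun {_} R => match R with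
    | RelSymb.unary k => RelSymb.unary (cP k)
    | RelSymb.binary k => RelSymb.binary (cR k)

namespace Model

/-- The domain of one of the two coded models. -/
def dom (K : Model.{u}) (b : Bool) : Set K := K.ext (RelSymb.unary (cD b))

theorem mem_dom {K : Model.{u}} {b : Bool} {x : K} : x ∈ K.dom b ↔ K.un (cD b) x := Iff.rfl

/-- One of the two coded models. -/
def part (K : Model.{u}) (b : Bool) (h : (K.dom b).Nonempty) : Model.{u} :=
  (K.restrict (K.dom b) h).rename decode

theorem part_un (K : Model.{u}) (b : Bool) (h : (K.dom b).Nonempty) (k : ℕ) (x : K.dom b) :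
    (K.part b h).un k x ↔ K.un (cP k) x := by
  have : (fun i : Fin 1 => ((![x] i : K.dom b) : K)) = ![(x : K)] := by ext j; fin_cases j; rfl
  change Structure.RelMap _ (fun i : Fin 1 => ((![x] i : K.dom b) : K)) ↔ Structure.RelMap _ _
  rw [this]
  rfl

theorem part_bin (K : Model.{u}) (b : Bool) (h : (K.dom b).Nonempty) (k : ℕ) (x y : K.dom b) :
    (K.part b h).bin k x y ↔ K.bin (cR k) x y := by
  have : (fun i : Fin 2 => ((![x, y] i : K.dom b) : K)) = ![(x : K), (y : K)] := by
    ext j; fin_cases j <;> rfl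
  change Structure.RelMap _ (fun i : Fin 2 => ((![x, y] i : K.dom b) : K)) ↔ Structure.RelMap _ _
  rw [this]
  rfl

/-- The positions coded in `K` have the back-and-forth property at length `n`, and admissible
positions of length `n` preserve atomic formulas over the first `n` symbols. -/
structure CodesGame (K : Model.{u}) (n : ℕ) : Prop where
  nonempty : ∀ b, ∃ x, K.un (cD b) x
  start : ∃ p, K.un (cU 0) p
  -- Duplicator's reply needs no clause here: `total` at length `n + 1` provides an entry on both
  -- sides.
  forth : ∀ b, ∀ p x, K.un (cU n) p → K.un (cD b) x →
    ∃ p', K.bin (cE n) p p' ∧ K.un (cU (n + 1)) p' ∧ K.bin (cV b n) p' x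
  transfer : ∀ b, ∀ i < n, ∀ p p' x, K.bin (cE n) p p' → K.bin (cV b i) p x → K.bin (cV b i) p' x
  total : ∀ b, ∀ i < n, ∀ p, K.un (cU n) p → ∃ x, K.un (cD b) x ∧ K.bin (cV b i) p x
  functional : ∀ b, ∀ i < n, ∀ p x y, K.bin (cV b i) p x → K.bin (cV b i) p y → x = y
  eq : ∀ b b', ∀ i < n, ∀ j < n, ∀ p, K.un (cU n) p →
    (∃ x, K.bin (cV b i) p x ∧ K.bin (cV b j) p x) →
    ∃ x, K.bin (cV b' i) p x ∧ K.bin (cV b' j) p x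
  un : ∀ b b', ∀ k < n, ∀ i < n, ∀ p, K.un (cU n) p →
    (∃ x, K.bin (cV b i) p x ∧ K.un (cP k) x) → ∃ x, K.bin (cV b' i) p x ∧ K.un (cP k) x
  bin : ∀ b b', ∀ k < n, ∀ i < n, ∀ j < n, ∀ p, K.un (cU n) p →
    (∃ x, K.bin (cV b i) p x ∧ ∃ y, K.bin (cV b j) p y ∧ K.bin (cR k) x y) →
    ∃ x, K.bin (cV b' i) p x ∧ ∃ y, K.bin (cV b' j) p y ∧ K.bin (cR k) x y

end Model

-- For fixed `n`, the quantifiers over sides and over indices below `n` are finite conjunctions.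
open Logic in
theorem Logic.defines_codesGame {L : Logic.{u, v}} (hL : L.IsAbstract)
    (hExt : (FOVar.{u} 3).ContainedIn L) (n : ℕ) : L.Defines fun K => K.CodesGame n := by
  have lt {Q : ℕ → Model.{u} → Prop} (h : ∀ i, L.Defines (Q i)) :
    L.Defines fun K => ∀ i < n, Q i K := Defines.forall_lt hExt hL h n
  have bool {Q : Bool → Model.{u} → Prop} (h : ∀ b, L.Defines (Q b)) :
    L.Defines fun K => ∀ b, Q b K := Defines.forall_bool hL h
  have h₁ := bool fun b => defines_exists_un hExt (cD b)
  have h₂ := defines_exists_un hExt (cU 0)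
  have h₃ := bool fun b => defines_forth hExt (cU n) (cD b) (cE n) (cU (n + 1)) (cV b n)
  have h₄ := bool fun b => lt fun i => defines_transfer hExt (cE n) (cV b i)
  have h₅ := bool fun b => lt fun i => defines_total hExt (cU n) (cD b) (cV b i)
  have h₆ := bool fun b => lt fun i => defines_functional hExt (cV b i)
  have h₇ := bool fun b => bool fun b' => lt fun i => lt fun j =>
    defines_eq hExt (cU n) (cV b i) (cV b j) (cV b' i) (cV b' j)
  have h₈ := bool fun b => bool fun b' => lt fun k => lt fun i =>
    defines_un hExt (cU n) (cV b i) (cV b' i) (cP k)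
  have h₉ := bool fun b => bool fun b' => lt fun k => lt fun i => lt fun j =>
    defines_bin hExt (cU n) (cV b i) (cV b j) (cV b' i) (cV b' j) (cR k)
  refine (h₁.and hL <| h₂.and hL <| h₃.and hL <| h₄.and hL <| h₅.and hL <| h₆.and hL <|
    h₇.and hL <| h₈.and hL h₉).congr fun K => ⟨?_, ?_⟩
  · rintro ⟨k₁, k₂, k₃, k₄, k₅, k₆, k₇, k₈, k₉⟩
    exact ⟨k₁, k₂, k₃, k₄, k₅, k₆, k₇, k₈, k₉⟩
  · rintro ⟨k₁, k₂, k₃, k₄, k₅, k₆, k₇, k₈, k₉⟩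
    exact ⟨k₁, k₂, k₃, k₄, k₅, k₆, k₇, k₈, k₉⟩

/-- A coded model is a relativisation followed by a renaming. Nonemptiness is a separate conjunct
because the relativised sentence is controlled only when the predicate is nonempty. -/
theorem Logic.defines_part {L : Logic.{u, v}} (hL : L.IsAbstract)
    (hExt : (FOVar.{u} 3).ContainedIn L) (φ : L.Fml) (b : Bool) :
    L.Defines fun K => ∃ h : (K.dom b).Nonempty, L.Sat (K.part b h) φ := by
  obtain ⟨ψ, hψ⟩ := hL.closed_rename decode φ
  obtain ⟨χ, hχ⟩ := hL.closed_restrict ψ (RelSymb.unary (cD b))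
  have hne : L.Defines fun K => (K.dom b).Nonempty := Logic.defines_exists_un hExt (cD b)
  refine (hne.and hL ⟨χ, fun K => Iff.rfl⟩).congr fun K => ?_
  constructor
  · exact fun ⟨h, h'⟩ => ⟨h, (hψ _).1 ((hχ K h).1 h')⟩
  · exact fun ⟨h, h'⟩ => ⟨h, (hχ K h).2 ((hψ _).2 h')⟩

/-! ### Back-and-forth along an infinite play -/

namespace Model

/-- In a countable model coding a game of infinite length, the two coded models are isomorphic. -/
theorem nonempty_part_equiv (K : Model.{u}) [Countable K] (hK : ∀ n, K.CodesGame n)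
    (h : ∀ b, (K.dom b).Nonempty) :
    Nonempty (K.part true (h true) ≃[vocab] K.part false (h false)) := by
  have hne (b : Bool) : Nonempty (K.dom b) := (h b).to_subtype
  choose e he using fun b => exists_surjective_nat (K.dom b)
  obtain ⟨p₀, hp₀⟩ := (hK 0).start
  -- In round `n` Spoiler plays on side `n.bodd` the element numbered `n.div2`, so every element of
  -- either side is played.
  choose next hE hU hV using fun n (p : {p // K.un (cU n) p}) =>
    (hK n).forth n.bodd p (e n.bodd n.div2) p.2 (e n.bodd n.div2).2
  let p (n : ℕ) : {p // K.un (cU n) p} :=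
    Nat.rec ⟨p₀, hp₀⟩ (fun n q => ⟨next n q, hU n q⟩) n
  choose a ha haV using fun b i => (hK (i + 1)).total b i i.lt_succ_self (p (i + 1)) (p (i + 1)).2
  -- Entry `i`, fixed in the position of length `i + 1`, persists in all later positions.
  have hmono (b : Bool) (i n : ℕ) (hn : i + 1 ≤ n) : K.bin (cV b i) (p n).1 (a b i) := by
    induction n, hn using Nat.le_induction with
    | base => exact haV b i
    | succ n hn ih => exact (hK n).transfer b i hn _ _ _ (hE n (p n)) ih
  have huniq (b : Bool) (i n : ℕ) (hn : i < n) (x : K) (hx : K.bin (cV b i) (p n).1 x) :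
      x = a b i := (hK n).functional b i hn _ _ _ hx (hmono b i n hn)
  have hsurj (b : Bool) : Function.Surjective fun i => (⟨a b i, ha b i⟩ : K.dom b) := by
    intro x
    obtain ⟨l, rfl⟩ := he b x
    refine ⟨Nat.bit b l, Subtype.ext ?_⟩
    have := hV (Nat.bit b l) (p (Nat.bit b l))
    rw [Nat.bodd_bit, Nat.div2_bit] at this
    exact (huniq b _ _ (Nat.lt_succ_self _) _ this).symm
  have heq (b b' : Bool) (i j : ℕ) (hij : a b i = a b j) : a b' i = a b' j := by
    -- Each clause is applied at a length exceeding all indices involved, where the entries of the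
    -- play are already settled.
    have hi : i < i + j + 1 := by omega
    have hj : j < i + j + 1 := by omega
    obtain ⟨x, hx, hx'⟩ := (hK (i + j + 1)).eq b b' i hi j hj _ (p _).2
      ⟨_, hmono b i _ hi, hij ▸ hmono b j _ hj⟩
    rw [← huniq b' i _ hi x hx, huniq b' j _ hj x hx']
  have hun (b b' : Bool) (k i : ℕ) (hi : K.un (cP k) (a b i)) : K.un (cP k) (a b' i) := by
    have h1 : k < k + i + 1 := by omega
    have h2 : i < k + i + 1 := by omega
    obtain ⟨x, hx, hx'⟩ := (hK (k + i + 1)).un b b' k h1 i h2 _ (p _).2 ⟨_, hmono b i _ h2, hi⟩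
    exact huniq b' i _ h2 x hx ▸ hx'
  have hbin (b b' : Bool) (k i j : ℕ) (hij : K.bin (cR k) (a b i) (a b j)) :
      K.bin (cR k) (a b' i) (a b' j) := by
    have h1 : k < k + i + j + 1 := by omega
    have h2 : i < k + i + j + 1 := by omega
    have h3 : j < k + i + j + 1 := by omega
    obtain ⟨x, hx, y, hy, hxy⟩ := (hK (k + i + j + 1)).bin b b' k h1 i h2 j h3 _ (p _).2
      ⟨_, hmono b i _ h2, _, hmono b j _ h3, hij⟩
    exact huniq b' i _ h2 x hx ▸ huniq b' j _ h3 y hy ▸ hxy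
  refine nonempty_equiv_of_enum (M := K.part true (h true)) (N := K.part false (h false))
    (fun i => (⟨a true i, ha true i⟩ : K.dom true))
    (fun i => (⟨a false i, ha false i⟩ : K.dom false)) (hsurj true) (hsurj false) ?_ ?_ ?_
  · intro i j
    refine Subtype.ext_iff.trans (Iff.trans ?_ Subtype.ext_iff.symm)
    exact ⟨heq _ _ i j, heq _ _ i j⟩
  · intro k i
    rw [part_un, part_un]
    exact ⟨hun _ _ k i, hun _ _ k i⟩
  · intro k i j
    rw [part_bin, part_bin]
    exact ⟨hbin _ _ k i j, hbin _ _ k i j⟩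

/-! ### The model coding a finite game -/

/-- The model coding two given models together with the game on them. -/
def game (D : Bool → Model.{u}) (m : ℕ) : Model.{u} :=
  ofRel ((Σ b, D b) ⊕ (∀ b, ℕ → D b))
    (fun c z => (∃ k b x, c = cP k ∧ z = .inl ⟨b, x⟩ ∧ (D b).un k x) ∨
      (∃ n s, c = cU n ∧ z = .inr s ∧ Survives m (m + 1 - n) n s) ∨
      ∃ b x, c = cD b ∧ z = .inl ⟨b, x⟩)
    (fun c z z' => (∃ k b x y, c = cR k ∧ z = .inl ⟨b, x⟩ ∧ z' = .inl ⟨b, y⟩ ∧ (D b).bin k x y) ∨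
      (∃ n s s', c = cE n ∧ z = .inr s ∧ z' = .inr s' ∧ ∀ b, ∀ i < n, s' b i = s b i) ∨
      ∃ b i s, c = cV b i ∧ z = .inr s ∧ z' = .inl ⟨b, s b i⟩)

section game

variable {D : Bool → Model.{u}} {m : ℕ}

/-- The elements of the coding model that stand for elements of the coded models. -/
def ofElem (m : ℕ) (b : Bool) (x : D b) : game D m :=
  (.inl ⟨b, x⟩ : (Σ b, D b) ⊕ (∀ b, ℕ → D b))

/-- The elements of the coding model that stand for positions. -/
def ofPos (m : ℕ) (s : ∀ b, ℕ → D b) : game D m :=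
  (.inr s : (Σ b, D b) ⊕ (∀ b, ℕ → D b))

theorem toNat_injective : Function.Injective Bool.toNat := by decide

theorem ofElem_injective (b : Bool) : Function.Injective (ofElem (D := D) m b) := fun x y h => by
  simpa using Sum.inl.inj h

/-- Here and below, the first component of `Nat.pair` and the two sides of the sum rule out all but
one clause of `game`. -/
theorem game_cP {k : ℕ} {b : Bool} {x : D b} :
    (game D m).un (cP k) (ofElem m b x) ↔ (D b).un k x := by
  constructor
  · rintro (⟨k', b', x', hc, hz, h⟩ | ⟨n, s, hc, hz, h⟩ | ⟨b', x', hc, hz⟩)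
    · obtain ⟨-, rfl⟩ := Nat.pair_eq_pair.1 hc
      cases hz
      exact h
    · cases hz
    · simp at hc
  · exact fun h => .inl ⟨k, b, x, rfl, rfl, h⟩

theorem game_cU {n : ℕ} {z : game D m} :
    (game D m).un (cU n) z ↔ ∃ s, z = ofPos m s ∧ Survives m (m + 1 - n) n s := by
  constructor
  · rintro (⟨k', b', x', hc, hz, h⟩ | ⟨n, s, hc, hz, h⟩ | ⟨b', x', hc, hz⟩)
    · simp at hc
    · obtain ⟨-, rfl⟩ := Nat.pair_eq_pair.1 hc
      exact ⟨s, hz, h⟩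
    · simp at hc
  · exact fun ⟨s, hz, h⟩ => .inr (.inl ⟨n, s, rfl, hz, h⟩)

theorem game_cD {b : Bool} {z : game D m} :
    (game D m).un (cD b) z ↔ ∃ x, z = ofElem m b x := by
  constructor
  · rintro (⟨k', b', x', hc, hz, h⟩ | ⟨n, s, hc, hz, h⟩ | ⟨b', x', hc, hz⟩)
    · simp at hc
    · simp at hc
    · obtain rfl := toNat_injective (Nat.pair_eq_pair.1 hc).2
      exact ⟨x', hz⟩
  · exact fun ⟨x, hz⟩ => .inr (.inr ⟨b, x, rfl, hz⟩)

theorem game_cR {k : ℕ} {b : Bool} {x y : D b} :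
    (game D m).bin (cR k) (ofElem m b x) (ofElem m b y) ↔ (D b).bin k x y := by
  constructor
  · rintro (⟨k', b', x', y', hc, hz, hz', h⟩ | ⟨n, s, s', hc, hz, hz', h⟩ | ⟨b', i, s, hc, hz, hz'⟩)
    · obtain ⟨-, rfl⟩ := Nat.pair_eq_pair.1 hc
      cases hz
      cases hz'
      exact h
    · cases hz
    · cases hz
  · exact fun h => .inl ⟨k, b, x, y, rfl, rfl, rfl, h⟩

theorem game_cE {n : ℕ} {z z' : game D m} : (game D m).bin (cE n) z z' ↔
    ∃ s s', z = ofPos m s ∧ z' = ofPos m s' ∧ ∀ b, ∀ i < n, s' b i = s b i := by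
  constructor
  · rintro (⟨k', b', x', y', hc, hz, hz', h⟩ | ⟨n, s, s', hc, hz, hz', h⟩ | ⟨b', i, s, hc, hz, hz'⟩)
    · simp at hc
    · obtain ⟨-, rfl⟩ := Nat.pair_eq_pair.1 hc
      exact ⟨s, s', hz, hz', h⟩
    · have := (Nat.pair_eq_pair.1 hc).1
      omega
  · exact fun ⟨s, s', hz, hz', h⟩ => .inr (.inl ⟨n, s, s', rfl, hz, hz', h⟩)

theorem game_cV {b : Bool} {i : ℕ} {z z' : game D m} : (game D m).bin (cV b i) z z' ↔
    ∃ s, z = ofPos m s ∧ z' = ofElem m b (s b i) := by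
  constructor
  · rintro (⟨k', b', x', y', hc, hz, hz', h⟩ | ⟨n, s, s', hc, hz, hz', h⟩ | ⟨b', i, s, hc, hz, hz'⟩)
    · have := (Nat.pair_eq_pair.1 hc).1
      omega
    · have := (Nat.pair_eq_pair.1 hc).1
      omega
    · obtain ⟨hb, rfl⟩ := Nat.pair_eq_pair.1 hc
      obtain rfl := toNat_injective (Nat.add_left_cancel hb)
      exact ⟨s, hz, hz'⟩
  · exact fun ⟨s, hz, hz'⟩ => .inr (.inr ⟨b, i, s, rfl, hz, hz'⟩)

theorem game_cV_ofPos {b : Bool} {i : ℕ} {s : ∀ b, ℕ → D b} {z' : game D m} :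
    (game D m).bin (cV b i) (ofPos m s) z' ↔ z' = ofElem m b (s b i) := by
  rw [game_cV]
  constructor
  · rintro ⟨s', hs, hz⟩
    cases Sum.inr.inj hs
    exact hz
  · exact fun hz => ⟨s, rfl, hz⟩

/-- Admissible positions of length `n` have `m + 1 - n` rounds left. The game starts with `m + 1`
rounds rather than `m` because `forth` at `n = m` still demands a move. -/
theorem codesGame_game {s : ∀ b, ℕ → D b} (hs : Survives m (m + 1) 0 s) {n : ℕ} (hn : n ≤ m) :
    (game D m).CodesGame n where
  nonempty b := ⟨ofElem m b (Classical.arbitrary _), game_cD.2 ⟨_, rfl⟩⟩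
  start := ⟨ofPos m s, game_cU.2 ⟨s, rfl, hs⟩⟩
  forth b p x hp hx := by
    obtain ⟨t, rfl, ht⟩ := game_cU.1 hp
    obtain ⟨x, rfl⟩ := game_cD.1 hx
    rw [show m + 1 - n = m + 1 - (n + 1) + 1 by omega] at ht
    obtain ⟨t', h1, h2, h3⟩ := ht.2 b x
    exact ⟨ofPos m t', game_cE.2 ⟨t, t', rfl, rfl, h1⟩, game_cU.2 ⟨t', rfl, h3⟩,
      game_cV_ofPos.2 (h2 ▸ rfl)⟩
  transfer b i hi p p' x hp hx := by
    obtain ⟨t, t', rfl, rfl, h⟩ := game_cE.1 hp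
    rw [game_cV_ofPos] at hx ⊢
    rw [hx, h b i hi]
  total b i hi p hp := by
    obtain ⟨t, rfl, ht⟩ := game_cU.1 hp
    exact ⟨ofElem m b (t b i), game_cD.2 ⟨_, rfl⟩, game_cV_ofPos.2 rfl⟩
  functional b i hi p x y hx hy := by
    obtain ⟨t, rfl, rfl⟩ := game_cV.1 hx
    exact (game_cV_ofPos.1 hy).symm
  eq b b' i hi j hj p hp := by
    obtain ⟨t, rfl, ht⟩ := game_cU.1 hp
    simp only [game_cV_ofPos, exists_eq_left, (ofElem_injective _).eq_iff]
    exact ht.sameAtoms.eq b b' i hi j hj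
  un b b' k hk i hi p hp := by
    obtain ⟨t, rfl, ht⟩ := game_cU.1 hp
    simp only [game_cV_ofPos, exists_eq_left, game_cP]
    exact ht.sameAtoms.un b b' k (hk.trans_le hn) i hi
  bin b b' k hk i hi j hj p hp := by
    obtain ⟨t, rfl, ht⟩ := game_cU.1 hp
    simp only [game_cV_ofPos, exists_eq_left, game_cR]
    exact ht.sameAtoms.bin b b' k (hk.trans_le hn) i hi j hj

theorem game_dom_nonempty (b : Bool) : ((game D m).dom b).Nonempty :=
  ⟨ofElem m b (Classical.arbitrary _), mem_dom.2 (game_cD.2 ⟨_, rfl⟩)⟩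

theorem nonempty_equiv_part_game (b : Bool) :
    Nonempty (D b ≃[vocab] (game D m).part b (game_dom_nonempty b)) := by
  let f (x : D b) : (game D m).dom b := ⟨ofElem m b x, mem_dom.2 (game_cD.2 ⟨x, rfl⟩)⟩
  refine nonempty_equiv_of_bijective (N := (game D m).part b (game_dom_nonempty b)) f ⟨?_, ?_⟩ ?_ ?_
  · exact fun x y h => ofElem_injective b (congrArg Subtype.val h)
  · rintro ⟨z, hz⟩
    obtain ⟨x, rfl⟩ := game_cD.1 (mem_dom.1 hz)
    exact ⟨x, rfl⟩
  · exact fun i x => (part_un _ b _ i (f x)).trans game_cP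
  · exact fun i x y => (part_bin _ b _ i (f x) (f y)).trans game_cR

end game

end Model

/-- Lindström's theorem: every sentence of an abstract logic extending `FO³` with Compactness and
the Löwenheim–Skolem property is equivalent to a first-order sentence. -/
theorem Logic.exists_equivalent_sentence {L : Logic.{u, v}} (hL : L.IsAbstract)
    (hExt : (FOVar.{u} 3).ContainedIn L) (hc : L.HasCompactness) (hls : L.HasLowenheimSkolem)
    (φ : L.Fml) : ∃ ψ : vocab.Sentence, ∀ M : Model.{u}, L.Sat M φ ↔ FO.{u}.Sat M ψ := by
  by_contra hφ
  have hex (m : ℕ) : ∃ (D : Bool → Model.{u}) (s : ∀ b, ℕ → D b), Survives m (m + 1) 0 s ∧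
      L.Sat (D true) φ ∧ ¬ L.Sat (D false) φ := by
    by_contra! h
    exact hφ (exists_sentence_of_survives (fun M => L.Sat M φ) m (m + 1) h)
  -- The failure of `φ` on the second side must itself be a sentence to survive the passage to the
  -- countable model.
  obtain ⟨χ, hχ⟩ := hL.closed_neg φ
  obtain ⟨K, hK, hgame⟩ := Logic.exists_countable_model hc hls
    (fun n => (Logic.defines_codesGame hL hExt n).and hL
      ((Logic.defines_part hL hExt φ true).and hL (Logic.defines_part hL hExt χ false)))
    fun m => by
      obtain ⟨D, s, hs, ht, hf⟩ := hex m
      refine ⟨Model.game D m, fun n hn => ⟨Model.codesGame_game hs hn,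
        ⟨Model.game_dom_nonempty true, ?_⟩, ⟨Model.game_dom_nonempty false, ?_⟩⟩⟩
      · exact hL.iso_invariant _ _ (Model.nonempty_equiv_part_game true) φ ht
      · exact hL.iso_invariant _ _ (Model.nonempty_equiv_part_game false) χ ((hχ _).2 hf)
  -- The conditions on `φ` and `χ` do not depend on the index, so `0` is as good as any.
  obtain ⟨-, ⟨ht, hφt⟩, ⟨hf, hχf⟩⟩ := hgame 0
  refine (hχ _).1 hχf (hL.iso_invariant _ _ ?_ φ hφt)
  exact K.nonempty_part_equiv (fun n => (hgame n).1) (Bool.rec hf ht)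

end AbstractModelTheory

theorem mainTheorem1 (L : AbstractModelTheory.Logic.{u, v}) (hL : L.IsAbstract)
    (hExt : (AbstractModelTheory.FOVar.{u} 3).ContainedIn L) :
    L.ContainedIn AbstractModelTheory.FO.{u} ↔ L.HasCompactness ∧ L.HasLowenheimSkolem := by
  constructor
  · exact fun h => ⟨h.hasCompactness AbstractModelTheory.FO.hasCompactness,
      h.hasLowenheimSkolem AbstractModelTheory.FO.hasLowenheimSkolem⟩
  · rintro ⟨hc, hls⟩
    choose f hf using L.exists_equivalent_sentence hL hExt hc hls
    exact ⟨f, fun M φ => hf φ M⟩
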